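/- Let $T$ be a complete first-order theory, and let $\mathbb U$ be a monster model of $T$, that is, a model which is $\kappa$-saturated and strongly $\kappa$-homogeneous for some cardinal $\kappa>|L|+\aleph_0$; sets of cardinality $<\kappa$ are called small, and Morley rank $MR$ of definable sets and Lascar rank $U$ of complete types over small sets are computed in $\mathbb U$. For a small set $A$ and an $A$-definable set $X\subseteq\mathbb U^n$ put $U(X)=\sup\{U(\mathrm{tp}(a/A)) : a\in X\}$; set $MR(\emptyset)=U(\emptyset)=-\infty$. Suppose that $T$ has finite Morley rank (i.e. the formula $x=x$ in one variable has finite Morley rank), and that Morley rank and Lascar rank coincide on definable sets, i.e. $MR(X)=U(X)$ for every definable set $X\subseteq \mathbb U^n$, $n\ge 0$. Then Morley rank is downward semi-definable: for every small set of parameters $A$, every $A$-definable family $(E_b)_{b\in B}$ of definable sets (that is, $B\subseteq\mathbb U^k$ and $\{(b,e): b\in B,\ e\in E_b\}\subseteq \mathbb U^{k}\times\mathbb U^{n}$ are $A$-definable), and every $b\in B$, there is an $A$-definable set $B'\subseteq B$ with $b\in B'$ such that $MR(E_{b'})\le MR(E_b)$ for all $b'\in B'$. -/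

import Mathlib

open FirstOrder Cardinal

universe u v w

namespace MorleyLascar

variable {L : FirstOrder.Language.{u, v}} {M : Type w} [L.Structure M]

/-! ### Monster models -/

/-- `M` is `κ`-saturated: every finitely satisfiable set of formulas, in finitely many variables,
with parameters in a subset of cardinality `< κ`, is realized in `M`. -/
def IsSaturated (L : FirstOrder.Language.{u, v}) (κ : Cardinal.{w}) (M : Type w)
    [L.Structure M] : Prop :=
  ∀ A : Set M, #A < κ → ∀ (ι : Type) [Finite ι] (p : Set (L[[A]].Formula ι)),
    (∀ s : Finset (L[[A]].Formula ι), (s : Set (L[[A]].Formula ι)) ⊆ p →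
      ∃ x : ι → M, ∀ φ ∈ s, φ.Realize x) →
    ∃ x : ι → M, ∀ φ ∈ p, φ.Realize x

/-- `M` is strongly `κ`-homogeneous: every partial elementary map of `M` whose domain has
cardinality `< κ` extends to an automorphism of `M`. -/
def IsStronglyHomogeneous (L : FirstOrder.Language.{u, v}) (κ : Cardinal.{w}) (M : Type w)
    [L.Structure M] : Prop :=
  ∀ A : Set M, #A < κ → ∀ f : A → M,
    (∀ φ : L.Formula A, φ.Realize (fun a : A => (a : M)) ↔ φ.Realize f) →
    ∃ σ : M ≃[L] M, ∀ a : A, σ a = f a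

/-- `M` is a monster model (universal domain), where "small" means "of cardinality `< κ`":
`κ` is larger than `ℵ₀` and than the cardinality of the language, and `M` is `κ`-saturated and
strongly `κ`-homogeneous. -/
structure IsMonster (L : FirstOrder.Language.{u, v}) (κ : Cardinal.{w}) (M : Type w)
    [L.Structure M] : Prop where
  aleph0_lt : ℵ₀ < κ
  card_lt : Cardinal.lift.{w} L.card < Cardinal.lift.{max u v} κ
  saturated : IsSaturated L κ M
  homogeneous : IsStronglyHomogeneous L κ M

/-! ### Rank values -/

/-- Values of ranks: `-∞` (the rank of the empty set), the ordinals, and `∞`. -/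
abbrev RankValue : Type (w + 1) := WithBot (WithTop Ordinal.{w})

/-- An ordinal, seen as a value of a rank. -/
def ofOrdinal (α : Ordinal.{w}) : RankValue.{w} := ((α : WithTop Ordinal.{w}) : RankValue.{w})

/-! ### Morley rank -/

/-- `MR(X) ≥ α`, for a definable set `X` in a monster model: `MR(X) ≥ 0` iff `X` is nonempty, and
for `α > 0`, `MR(X) ≥ α` iff for each `β < α` there are infinitely many pairwise disjoint definable
(with parameters) subsets of `X` of Morley rank `≥ β`. -/
def MorleyRankGE (L : FirstOrder.Language.{u, v}) [L.Structure M] {ι : Type}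
    (α : Ordinal.{w}) (X : Set (ι → M)) : Prop :=
  X.Nonempty ∧ ∀ β < α, ∃ D : ℕ → Set (ι → M),
    (∀ i, Set.univ.Definable L (D i) ∧ D i ⊆ X ∧ MorleyRankGE L β (D i)) ∧
    ∀ i j, i ≠ j → Disjoint (D i) (D j)
termination_by α

/-- The Morley rank of a definable set in a monster model. -/
noncomputable def morleyRank (L : FirstOrder.Language.{u, v}) [L.Structure M] {ι : Type}
    (X : Set (ι → M)) : RankValue.{w} :=
  sSup {r | ∃ α : Ordinal.{w}, MorleyRankGE L α X ∧ r = ofOrdinal α}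

/-! ### Types, dividing and forking -/

/-- `a` and `b` have the same type over `A`. -/
def SameType (L : FirstOrder.Language.{u, v}) [L.Structure M] {ι : Type}
    (A : Set M) (a b : ι → M) : Prop :=
  ∀ φ : L[[A]].Formula ι, φ.Realize a ↔ φ.Realize b

/-- The fibre `E_b = {e | (b, e) ∈ E}` of a family of sets. -/
def fiber {ι η : Type} (E : Set (η ⊕ ι → M)) (b : η → M) : Set (ι → M) :=
  {e | Sum.elim b e ∈ E}

/-- The definable set `X` divides over `A`: it is `φ(M, c)` for an `L`-formula `φ(y, x)` and a
finite tuple `c`, and there are `k` and a sequence `(cᵢ)` of realizations of `tp(c/A)` such that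
any `k` of the sets `φ(M, cᵢ)` have empty intersection. -/
def Divides (L : FirstOrder.Language.{u, v}) [L.Structure M] {ι : Type}
    (A : Set M) (X : Set (ι → M)) : Prop :=
  ∃ (m : ℕ) (φ : L.Formula (Fin m ⊕ ι)) (c : Fin m → M),
    X = {x | φ.Realize (Sum.elim c x)} ∧
    ∃ (k : ℕ) (d : ℕ → Fin m → M), (∀ i, SameType L A (d i) c) ∧
      ∀ s : Finset ℕ, s.card = k → ¬ ∃ x : ι → M, ∀ i ∈ s, φ.Realize (Sum.elim (d i) x)

/-- The definable set `X` forks over `A`: it is covered by finitely many definable sets which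
divide over `A`. -/
def Forks (L : FirstOrder.Language.{u, v}) [L.Structure M] {ι : Type}
    (A : Set M) (X : Set (ι → M)) : Prop :=
  ∃ (n : ℕ) (Y : Fin n → Set (ι → M)), (∀ i, Divides L A (Y i)) ∧ X ⊆ ⋃ i, Y i

/-- The type `tp(a/B)` forks over `A`: it contains a formula which forks over `A`. -/
def TypeForks (L : FirstOrder.Language.{u, v}) [L.Structure M] {ι : Type}
    (A B : Set M) (a : ι → M) : Prop :=
  ∃ X : Set (ι → M), B.Definable L X ∧ a ∈ X ∧ Forks L A X

/-! ### Lascar rank -/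

/-- `U(tp(a/A)) ≥ α`: for each `β < α` the type `tp(a/A)` has an extension `tp(a'/B)` to a small
set `B ⊇ A`, which forks over `A` and satisfies `U(tp(a'/B)) ≥ β`. -/
def LascarRankGE (L : FirstOrder.Language.{u, v}) [L.Structure M] (κ : Cardinal.{w}) {ι : Type}
    (α : Ordinal.{w}) (A : Set M) (a : ι → M) : Prop :=
  ∀ β < α, ∃ (B : Set M) (a' : ι → M), A ⊆ B ∧ #B < κ ∧ SameType L A a' a ∧
    TypeForks L A B a' ∧ LascarRankGE L κ β B a'
termination_by α

/-- The Lascar rank `U(a/A)` of the type `tp(a/A)`. -/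
noncomputable def lascarRankType (L : FirstOrder.Language.{u, v}) [L.Structure M]
    (κ : Cardinal.{w}) {ι : Type} (A : Set M) (a : ι → M) : RankValue.{w} :=
  sSup {r | ∃ α : Ordinal.{w}, LascarRankGE L κ α A a ∧ r = ofOrdinal α}

/-- The Lascar rank of an `A`-definable set `X`, the supremum of the ranks `U(a/A)` for
`a ∈ X`. -/
noncomputable def lascarRank (L : FirstOrder.Language.{u, v}) [L.Structure M]
    (κ : Cardinal.{w}) {ι : Type} (A : Set M) (X : Set (ι → M)) : RankValue.{w} :=
  ⨆ a ∈ X, lascarRankType L κ A a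

/-! ### The properties in the theorem -/

/-- Finite Morley rank: the formula `x = x`, in one variable, has finite Morley rank. -/
def HasFiniteMorleyRank (L : FirstOrder.Language.{u, v}) (M : Type w) [L.Structure M] : Prop :=
  ∃ n : ℕ, morleyRank L (Set.univ : Set (Fin 1 → M)) = ofOrdinal (n : Ordinal.{w})

/-- Morley rank and Lascar rank coincide on definable sets: for each small `A` and each
`A`-definable set `X` of finite tuples, `MR(X) = U(X)`. -/
def MorleyEqLascar (L : FirstOrder.Language.{u, v}) (κ : Cardinal.{w}) (M : Type w)
    [L.Structure M] : Prop :=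
  ∀ (ι : Type) [Finite ι] (A : Set M), #A < κ → ∀ X : Set (ι → M), A.Definable L X →
    morleyRank L X = lascarRank L κ A X

/-- Morley rank is downward semi-definable: for each small `A`, each `A`-definable family
`E_b` (`b ∈ B`) and each `b ∈ B`, there is an `A`-definable `B' ⊆ B` with `b ∈ B'` and
`MR(E_b') ≤ MR(E_b)` for all `b' ∈ B'`. -/
def DownwardSemiDefinable (L : FirstOrder.Language.{u, v}) (κ : Cardinal.{w}) (M : Type w)
    [L.Structure M] : Prop :=
  ∀ (ι η : Type) [Finite ι] [Finite η] (A : Set M), #A < κ →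
    ∀ (B : Set (η → M)) (E : Set (η ⊕ ι → M)), A.Definable L B → A.Definable L E →
      ∀ b ∈ B, ∃ B' ⊆ B, A.Definable L B' ∧ b ∈ B' ∧
        ∀ b' ∈ B', morleyRank L (fiber E b') ≤ morleyRank L (fiber E b)

end MorleyLascar

/-!
Since Morley and Lascar rank agree on definable sets, Morley rank inherits the inequality of Lascar
`U(ba/A) ≤ U(b/A) + U(a/Ab)` (`LascarRankGE.exists_add_eq`), while it also satisfies the evident
`MR(S × T) ≥ MR(S) + MR(T)` (`MorleyRankGE.prod`). Hence the ranks in question are finite, and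
`MR(X^N) = N * MR(X)`.

Let `MR(E_b) = d`, and suppose that each `A`-definable `C ∋ b` in `B` contains some `b'` with
`MR(E_b') > d`. Choose `N > U(b/A)`, and let `E^N|C` be the family of the powers `(E_c)^N`, `c ∈ C`.
Then `MR(E^N|C) ≥ N * (d + 1) > U(b/A) + N * d`, and by the inequality of Lascar the right hand side
bounds the rank of points of `E^N` over realizations of `tp(b/A)`. Take `C` such that
`e = MR(E^N|C)` is minimal. A point of `E^N|C` of rank `e` lies over some `c` which does not realize
`tp(b/A)`, so it lies over an `A`-definable `D ⊆ C` with `b ∉ D`, and `MR(E^N|D) ≥ e`. By minimality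
the same applies to `C \ D`, and so on. This gives infinitely many disjoint definable subsets of
`E^N|C` of rank `e`, so that `MR(E^N|C) > e`, a contradiction
(`exists_definable_forall_not_morleyRankGE`).

The inequality of Lascar rests on left transitivity of forking (`TypeForks.left_or_right`), which
holds in an arbitrary theory. It reduces to left transitivity of dividing
(`DividesAlong.divides_fiber`), for which saturation (`IsSaturated.exists_seq_forall_mem`) replaces
the usual argument with indiscernible sequences. Definable sets are used in place of formulas
throughout: the sets definable over `A ∪ range p` are the fibres at `p` of those definable over `A`
(`definable_fiber`, `exists_eq_fiber`).
-/

namespace MorleyLascar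

variable {L : FirstOrder.Language.{u, v}} {M : Type w} [L.Structure M]

/-! ### Definable sets -/

theorem definable_of_mem_iff_comp {α β : Type*} {A : Set M} {S : Set (α → M)} {X : Set (β → M)}
    (hS : A.Definable L S) (f : α → β) (h : ∀ g, g ∈ X ↔ g ∘ f ∈ S) : A.Definable L X := by
  have : X = (fun g : β → M => g ∘ f) ⁻¹' S := Set.ext h
  exact this ▸ hS.preimage_comp f

theorem definable_of_mem_iff_exists {α β : Type*} [Finite β] {A : Set M} {S : Set (α ⊕ β → M)}
    {X : Set (α → M)} (hS : A.Definable L S) (h : ∀ g, g ∈ X ↔ ∃ u, Sum.elim g u ∈ S) :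
    A.Definable L X := by
  have : X = {v : α → M | ∃ u : β → M, Sum.elim v u ∈ S} := Set.ext h
  exact this ▸ hS.exists_of_finite

theorem definable_of_mem_iff_forall {α β : Type*} [Finite β] {A : Set M} {S : Set (α ⊕ β → M)}
    {X : Set (α → M)} (hS : A.Definable L S) (h : ∀ g, g ∈ X ↔ ∀ u, Sum.elim g u ∈ S) :
    A.Definable L X := by
  have : X = {v : α → M | ∀ u : β → M, Sum.elim v u ∈ S} := Set.ext h
  exact this ▸ hS.forall_of_finite

theorem definable_of_mem_iff_finset_forall {α I : Type*} {A : Set M} {S : I → Set (α → M)}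
    {X : Set (α → M)} (s : Finset I) (hS : ∀ i, A.Definable L (S i))
    (h : ∀ g, g ∈ X ↔ ∀ i ∈ s, g ∈ S i) : A.Definable L X := by
  have : X = ⋂ i ∈ s, S i := by ext g; simp [h]
  exact this ▸ Set.definable_biInter_finset hS s

theorem definable_of_mem_iff_finset_exists {α I : Type*} {A : Set M} {S : I → Set (α → M)}
    {X : Set (α → M)} (s : Finset I) (hS : ∀ i, A.Definable L (S i))
    (h : ∀ g, g ∈ X ↔ ∃ i ∈ s, g ∈ S i) : A.Definable L X := by
  have : X = ⋃ i ∈ s, S i := by ext g; simp [h]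
  exact this ▸ Set.definable_biUnion_finset hS s

@[simp]
theorem mem_fiber {ι η : Type} {E : Set (η ⊕ ι → M)} {b : η → M} {e : ι → M} :
    e ∈ fiber E b ↔ Sum.elim b e ∈ E := Iff.rfl

/-- A definable set in an arbitrary, possibly infinite, set of variables depends only on finitely
many of them. -/
theorem exists_finset_definable {α : Type*} {A : Set M} {X : Set (α → M)} (hX : A.Definable L X) :
    ∃ (F : Finset α) (Y : Set (F → M)), A.Definable L Y ∧
      ∀ g, g ∈ X ↔ (fun i : F => g i) ∈ Y := by
  classical
  obtain ⟨φ, rfl⟩ := hX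
  let ψ : L[[A]].Formula φ.freeVarFinset := φ.restrictFreeVar id
  refine ⟨φ.freeVarFinset, _, ⟨ψ, rfl⟩, fun g => ?_⟩
  simp only [Set.mem_ofPred_eq, Language.Formula.Realize]
  exact (Language.BoundedFormula.realize_restrictFreeVar (L := L[[A]]) (φ := φ) (f := id) g
    (fun _ => rfl)).symm

theorem definable_fiber {ι η : Type} {A : Set M} {R : Set (η ⊕ ι → M)} (hR : A.Definable L R)
    (p : η → M) : (A ∪ Set.range p).Definable L (fiber R p) := by
  obtain ⟨φ, rfl⟩ := Set.definable_iff_exists_formula_sum.1 hR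
  refine Set.definable_iff_exists_formula_sum.2 ⟨φ.relabel (Sum.elim
    (fun a : A => Sum.inl ⟨a, Or.inl a.2⟩)
    (Sum.elim (fun j => Sum.inl ⟨p j, Or.inr ⟨j, rfl⟩⟩) Sum.inr)), ?_⟩
  ext x
  rw [mem_fiber, Set.mem_ofPred_eq, Set.mem_ofPred_eq, Language.Formula.realize_relabel]
  refine iff_of_eq (congrArg _ (funext ?_))
  rintro (a | j | i) <;> rfl

theorem exists_eq_fiber {ι η : Type} {A : Set M} {p : η → M} {X : Set (ι → M)}
    (hX : (A ∪ Set.range p).Definable L X) :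
    ∃ R : Set (η ⊕ ι → M), A.Definable L R ∧ X = fiber R p := by
  classical
  obtain ⟨φ, rfl⟩ := Set.definable_iff_exists_formula_sum.1 hX
  have key : ∀ z : ↥(A ∪ Set.range p), ∃ t : A ⊕ η, Sum.elim (fun a : A => (a : M)) p t = z := by
    rintro ⟨z, hz | ⟨j, rfl⟩⟩
    · exact ⟨Sum.inl ⟨z, hz⟩, rfl⟩
    · exact ⟨Sum.inr j, rfl⟩
  choose h hh using key
  refine ⟨_, Set.definable_iff_exists_formula_sum.2 ⟨φ.relabel (Sum.elim
    (fun z => (Sum.elim Sum.inl (fun j => Sum.inr (Sum.inl j)) (h z)))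
    (fun i => Sum.inr (Sum.inr i))), rfl⟩, ?_⟩
  ext x
  rw [mem_fiber, Set.mem_ofPred_eq, Set.mem_ofPred_eq, Language.Formula.realize_relabel]
  refine iff_of_eq (congrArg _ (funext ?_))
  rintro (z | i)
  · have := hh z
    simp only [Function.comp_apply, Sum.elim_inl]
    rw [← this]
    cases h z <;> rfl
  · rfl

/-! ### Types -/

theorem sameType_iff {ι : Type} {A : Set M} {a b : ι → M} :
    SameType L A a b ↔ ∀ X : Set (ι → M), A.Definable L X → (a ∈ X ↔ b ∈ X) := by
  constructor
  · rintro h X ⟨φ, rfl⟩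
    exact h φ
  · intro h φ
    exact h _ ⟨φ, rfl⟩

/-- Types are complete, so that an inclusion between them is an equality. -/
theorem sameType_of_forall_mem {ι : Type} {A : Set M} {a b : ι → M}
    (h : ∀ X : Set (ι → M), A.Definable L X → b ∈ X → a ∈ X) : SameType L A a b :=
  sameType_iff.2 fun X hX => ⟨fun ha => by_contra fun hb => h Xᶜ hX.compl hb ha, h X hX⟩

namespace SameType

variable {ι : Type} {A B : Set M} {a b c : ι → M}

theorem mem_iff (h : SameType L A a b) {X : Set (ι → M)} (hX : A.Definable L X) :
    a ∈ X ↔ b ∈ X := sameType_iff.1 h X hX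

theorem refl (a : ι → M) : SameType L A a a := fun _ => Iff.rfl

theorem symm (h : SameType L A a b) : SameType L A b a := fun φ => (h φ).symm

theorem trans (h : SameType L A a b) (h' : SameType L A b c) : SameType L A a c :=
  fun φ => (h φ).trans (h' φ)

theorem mono (hAB : A ⊆ B) (h : SameType L B a b) : SameType L A a b :=
  sameType_iff.2 fun _ hX => h.mem_iff (hX.mono hAB)

theorem comp {η : Type} (h : SameType L A a b) (f : η → ι) : SameType L A (a ∘ f) (b ∘ f) :=
  sameType_iff.2 fun _ hX => h.mem_iff (hX.preimage_comp f)

theorem sumElim {η : Type} {p : η → M} (h : SameType L (A ∪ Set.range p) a b) :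
    SameType L A (Sum.elim p a) (Sum.elim p b) :=
  sameType_iff.2 fun _ hX => h.mem_iff (definable_fiber hX p)

theorem sumElim_of_range_subset {η : Type} {p : η → M} (hp : Set.range p ⊆ A)
    (h : SameType L A a b) : SameType L A (Sum.elim p a) (Sum.elim p b) := by
  rw [← Set.union_eq_self_of_subset_right hp] at h
  exact h.sumElim

end SameType

/-! ### Saturation -/

theorem mk_union_range_lt {κ : Cardinal.{w}} (hκ : ℵ₀ < κ) {A : Set M} (hA : #A < κ) {η : Type}
    [Finite η] (p : η → M) : #(A ∪ Set.range p : Set M) < κ :=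
  (mk_union_le _ _).trans_lt (add_lt_of_lt hκ.le hA
    ((lt_aleph0_iff_finite.2 (Set.finite_range p)).trans hκ))

theorem IsSaturated.exists_forall_mem {κ : Cardinal.{w}} (hM : IsSaturated L κ M) {A : Set M}
    (hA : #A < κ) {ι : Type} [Finite ι] {I : Type*} [Nonempty I] (S : I → Set (ι → M))
    (hS : ∀ i, A.Definable L (S i)) (hdir : Directed (· ⊇ ·) S) (hne : ∀ i, (S i).Nonempty) :
    ∃ x, ∀ i, x ∈ S i := by
  classical
  choose φ hφ using hS
  obtain ⟨x, hx⟩ := hM A hA ι (Set.range φ) (fun s hs => by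
    choose! g hg using fun ψ (hψ : ψ ∈ s) => hs hψ
    obtain ⟨z, hz⟩ := hdir.finset_le (s.image g)
    obtain ⟨x, hx⟩ := hne z
    refine ⟨x, fun ψ hψ => ?_⟩
    have : x ∈ S (g ψ) := hz _ (Finset.mem_image_of_mem _ hψ) hx
    rw [hφ, hg ψ hψ] at this
    exact this)
  refine ⟨x, fun i => ?_⟩
  rw [hφ]
  exact hx _ ⟨i, rfl⟩

/-- Saturation for infinite sequences of finite tuples. The tuples of the sequence are chosen one
after the other, each by saturation over those before it. -/
theorem IsSaturated.exists_seq_forall_mem {κ : Cardinal.{w}} (hM : IsSaturated L κ M)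
    (hκ : ℵ₀ < κ) {A : Set M} (hA : #A < κ) {ζ : Type} [Finite ζ] {I : Type*} [Nonempty I]
    (S : I → Set (ℕ × ζ → M)) (hS : ∀ i, A.Definable L (S i)) (hdir : Directed (· ⊇ ·) S)
    (hne : ∀ i, (S i).Nonempty) : ∃ x, ∀ i, x ∈ S i := by
  classical
  -- `Ext n x`: the first `n` tuples of `x` extend to members of each set of the family.
  let Ext : ℕ → (ℕ → ζ → M) → Prop := fun n x => ∀ i, ∃ g ∈ S i, ∀ j < n, ∀ z, g (j, z) = x j z
  have step : ∀ n x, Ext n x → ∃ y, Ext (n + 1) (Function.update x n y) := by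
    intro n x hx
    let p : Fin n × ζ → M := fun q => x q.1 q.2
    let T : I → Set (ζ → M) := fun i =>
      {y | ∃ g ∈ S i, ∀ j < n + 1, ∀ z, g (j, z) = Function.update x n y j z}
    have hT : ∀ i, (A ∪ Set.range p).Definable L (T i) := by
      intro i
      obtain ⟨F, Y, hY, hYS⟩ := exists_finset_definable (hS i)
      let R : Set ((Fin n × ζ) ⊕ ζ → M) := {w | ∃ v : F → M, (fun q : F =>
        if h : q.1.1 < n then w (Sum.inl (⟨q.1.1, h⟩, q.1.2))
        else if q.1.1 = n then w (Sum.inr q.1.2) else v q) ∈ Y}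
      have hR : A.Definable L R := by
        refine definable_of_mem_iff_exists (β := F) (definable_of_mem_iff_comp
          (X := {w : ((Fin n × ζ) ⊕ ζ) ⊕ F → M | (fun q : F =>
            if h : q.1.1 < n then w (Sum.inl (Sum.inl (⟨q.1.1, h⟩, q.1.2)))
            else if q.1.1 = n then w (Sum.inl (Sum.inr q.1.2)) else w (Sum.inr q)) ∈ Y}) hY
          (fun q : F => if h : q.1.1 < n then Sum.inl (Sum.inl (⟨q.1.1, h⟩, q.1.2))
            else if q.1.1 = n then Sum.inl (Sum.inr q.1.2) else Sum.inr q)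
          fun w => ?_) fun w => Iff.rfl
        rw [Set.mem_ofPred_eq]
        refine iff_of_eq (congrArg (· ∈ Y) (funext fun q => ?_))
        simp only [Function.comp_apply]
        split_ifs <;> rfl
      have hTR : T i = fiber R p := by
        ext y
        constructor
        · rintro ⟨g, hg, hgx⟩
          refine ⟨fun q => g q, ?_⟩
          rw [hYS] at hg
          convert hg using 1
          funext q
          split_ifs with h1 h2
          · rw [Sum.elim_inl]
            rw [show g q = g (q.1.1, q.1.2) from rfl, hgx _ (by omega),
              Function.update_of_ne (by omega)]
          · rw [Sum.elim_inr]
            rw [show g q = g (q.1.1, q.1.2) from rfl, hgx _ (by omega), h2,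
              Function.update_self]
          · rfl
        · rintro ⟨v, hv⟩
          obtain ⟨g₀, -⟩ := hne i
          refine ⟨fun q => if h : q.1 < n + 1 then Function.update x n y q.1 q.2
            else if hq : q ∈ F then v ⟨q, hq⟩ else g₀ q, ?_, fun j hj z => dif_pos hj⟩
          rw [hYS]
          convert hv using 1
          funext q
          by_cases h1 : q.1.1 < n
          · rw [dif_pos (by omega), dif_pos h1, Function.update_of_ne (by omega)]
            rfl
          · by_cases h2 : q.1.1 = n
            · rw [dif_pos (by omega), dif_neg h1, if_pos h2, h2, Function.update_self]
              rfl
            · rw [dif_neg (by omega), dif_neg h1, if_neg h2, dif_pos q.2]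
      rw [hTR]
      exact definable_fiber hR p
    obtain ⟨y, hy⟩ := hM.exists_forall_mem (mk_union_range_lt hκ hA p) T hT
      (fun i j => by
        obtain ⟨k, hki, hkj⟩ := hdir i j
        exact ⟨k, fun y ⟨g, hg, h⟩ => ⟨g, hki hg, h⟩, fun y ⟨g, hg, h⟩ => ⟨g, hkj hg, h⟩⟩)
      (fun i => by
        obtain ⟨g, hg, h⟩ := hx i
        refine ⟨fun z => g (n, z), g, hg, fun j hj z => ?_⟩
        rcases Nat.lt_succ_iff_lt_or_eq.1 hj with hj | rfl
        · rw [Function.update_of_ne hj.ne, h j hj]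
        · rw [Function.update_self])
    exact ⟨y, hy⟩
  obtain ⟨g₀, -⟩ := hne (Classical.arbitrary I)
  have : Nonempty (ζ → M) := ⟨fun z => g₀ (0, z)⟩
  choose! next hnext using step
  let X : ℕ → ℕ → ζ → M := fun n => Nat.rec (fun j z => g₀ (j, z))
    (fun n x => Function.update x n (next n x)) n
  have hX : ∀ n, Ext n (X n) := by
    intro n
    induction n with
    | zero =>
      intro i
      obtain ⟨g, hg⟩ := hne i
      exact ⟨g, hg, fun j hj => absurd hj (Nat.not_lt_zero _)⟩
    | succ n ih => exact hnext n _ ih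
  have hstab : ∀ n j, j < n → X n j = X (j + 1) j := by
    intro n
    induction n with
    | zero => intro j hj; exact absurd hj (Nat.not_lt_zero _)
    | succ n ih =>
      intro j hj
      rcases Nat.lt_succ_iff_lt_or_eq.1 hj with hj | rfl
      · rw [← ih j hj]
        exact Function.update_of_ne hj.ne _ _
      · rfl
  refine ⟨fun q => X (q.1 + 1) q.1 q.2, fun i => ?_⟩
  obtain ⟨F, Y, -, hYS⟩ := exists_finset_definable (hS i)
  obtain ⟨n, hn⟩ : ∃ n, ∀ q ∈ F, q.1 < n :=
    ⟨F.sup Prod.fst + 1, fun q hq => Nat.lt_succ_of_le (Finset.le_sup (f := Prod.fst) hq)⟩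
  obtain ⟨g, hg, hgX⟩ := hX n i
  rw [hYS] at hg ⊢
  convert hg using 1
  funext q
  rw [show g q = g (q.1.1, q.1.2) from rfl, hgX _ (hn _ q.2), hstab n _ (hn _ q.2)]

/-! ### Dividing and forking -/

/-- The fibre `S_c` divides over `A` by a sequence of parameters of type `tp(c/A)`. As opposed to
dividing of the set `S_c`, this refers to a chosen family `S` and parameter `c`, and it depends on
`c` only through `tp(c/A)`. -/
def DividesAlong (L : FirstOrder.Language.{u, v}) [L.Structure M] {ζ ι : Type} (A : Set M)
    (S : Set (ζ ⊕ ι → M)) (c : ζ → M) : Prop :=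
  ∃ (k : ℕ) (d : ℕ → ζ → M), (∀ i, SameType L A (d i) c) ∧
    ∀ s : Finset ℕ, s.card = k → ¬ ∃ x : ι → M, ∀ i ∈ s, Sum.elim (d i) x ∈ S

theorem DividesAlong.congr {ζ ι : Type} {A : Set M} {S : Set (ζ ⊕ ι → M)} {c c' : ζ → M}
    (h : DividesAlong L A S c) (hc : SameType L A c c') : DividesAlong L A S c' := by
  obtain ⟨k, d, hd, hk⟩ := h
  exact ⟨k, d, fun i => (hd i).trans hc, hk⟩

theorem Divides.exists_dividesAlong {ι : Type} {A : Set M} {X : Set (ι → M)}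
    (h : Divides L A X) : ∃ (m : ℕ) (S : Set (Fin m ⊕ ι → M)) (c : Fin m → M),
      A.Definable L S ∧ X = fiber S c ∧ DividesAlong L A S c := by
  obtain ⟨m, φ, c, rfl, k, d, hd, hk⟩ := h
  exact ⟨m, {w | φ.Realize w}, c,
    (Set.empty_definable_iff.2 ⟨φ, rfl⟩).mono (Set.empty_subset A), rfl, k, d, hd, hk⟩

/-- The parameters from `A` in a definition of `S` are added to the tuple `c`. -/
theorem DividesAlong.divides {ζ ι : Type} [Finite ζ] {A : Set M} {S : Set (ζ ⊕ ι → M)}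
    {c : ζ → M} (hS : A.Definable L S) (h : DividesAlong L A S c) : Divides L A (fiber S c) := by
  obtain ⟨k, d, hd, hk⟩ := h
  obtain ⟨A₀, hA₀, hS₀⟩ := Set.definable_iff_finitely_definable.1 hS
  obtain ⟨φ, hφ⟩ := Set.definable_iff_exists_formula_sum.1 hS₀
  obtain ⟨l, ⟨e₀⟩⟩ := Finite.exists_equiv_fin (A₀ : Set M)
  obtain ⟨m, ⟨e⟩⟩ := Finite.exists_equiv_fin (Fin l ⊕ ζ)
  let p : Fin l → M := fun j => e₀.symm j
  let tup : (ζ → M) → Fin m → M := fun c => Sum.elim p c ∘ e.symm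
  let ψ : L.Formula (Fin m ⊕ ι) := φ.relabel
    (Sum.elim (fun a => Sum.inl (e (Sum.inl (e₀ a))))
      (Sum.elim (fun z => Sum.inl (e (Sum.inr z))) Sum.inr))
  have hψ : ∀ c x, ψ.Realize (Sum.elim (tup c) x) ↔ Sum.elim c x ∈ S := by
    intro c x
    rw [hφ, Language.Formula.realize_relabel, Set.mem_ofPred_eq]
    refine iff_of_eq (congrArg _ (funext ?_))
    rintro (a | z | i) <;> simp [tup, p]
  have ht : ∀ i, SameType L A (tup (d i)) (tup c) := fun i =>
    (SameType.sumElim_of_range_subset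
      (Set.range_subset_iff.2 fun j => hA₀ (e₀.symm j).2) (hd i)).comp e.symm
  refine ⟨m, ψ, tup c, ?_, k, fun i => tup (d i), ht, ?_⟩
  · ext x
    exact (hψ c x).symm
  · rintro s hs ⟨x, hx⟩
    exact hk s hs ⟨x, fun i hi => (hψ _ _).1 (hx i hi)⟩

theorem definable_not_exists_forall_mem {ζ ι J : Type} [Finite ι] {A : Set M}
    {S : Set (ζ ⊕ ι → M)} (hS : A.Definable L S) (s : Finset J) :
    A.Definable L {g : J × ζ → M |
      ¬ ∃ x : ι → M, ∀ i ∈ s, Sum.elim (fun z => g (i, z)) x ∈ S} := by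
  refine Set.Definable.compl (definable_of_mem_iff_exists (β := ι)
    (definable_of_mem_iff_finset_forall (X := {w : (J × ζ) ⊕ ι → M | ∀ i ∈ s,
      w ∘ Sum.elim (fun z => Sum.inl (i, z)) Sum.inr ∈ S}) s
      (fun i => hS.preimage_comp _) fun w => Iff.rfl) fun g => ?_)
  refine exists_congr fun x => forall₂_congr fun i _ => iff_of_eq (congrArg (· ∈ S) (funext ?_))
  rintro (z | j) <;> rfl

/-- By saturation, infinite sequences witnessing dividing exist if finite ones do. -/
theorem IsSaturated.dividesAlong {κ : Cardinal.{w}} (hM : IsSaturated L κ M) (hκ : ℵ₀ < κ)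
    {A : Set M} (hA : #A < κ) {ζ ι : Type} [Finite ζ] [Finite ι] {S : Set (ζ ⊕ ι → M)}
    (hS : A.Definable L S) {c : ζ → M} (k : ℕ)
    (h : ∀ (n : ℕ) (Θ : Set (ζ → M)), A.Definable L Θ → c ∈ Θ →
      ∃ d : Fin n → ζ → M, (∀ i, d i ∈ Θ) ∧
        ∀ s : Finset (Fin n), s.card = k → ¬ ∃ x : ι → M, ∀ i ∈ s, Sum.elim (d i) x ∈ S) :
    DividesAlong L A S c := by
  classical
  let I := ℕ × {Θ : Set (ζ → M) // A.Definable L Θ ∧ c ∈ Θ}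
  have : Nonempty I := ⟨(0, ⟨Set.univ, Set.definable_univ, trivial⟩)⟩
  let T : I → Set (ℕ × ζ → M) := fun q =>
    {g | ∀ i ∈ Finset.range q.1, g ∘ (fun z => (i, z)) ∈ q.2.1} ∩
    {g | ∀ s ∈ Finset.powersetCard k (Finset.range q.1),
      ¬ ∃ x : ι → M, ∀ i ∈ s, Sum.elim (fun z => g (i, z)) x ∈ S}
  have hT : ∀ q, A.Definable L (T q) := fun q =>
    (definable_of_mem_iff_finset_forall _ (fun i => q.2.2.1.preimage_comp _)
      fun g => Iff.rfl).inter
    (definable_of_mem_iff_finset_forall _ (definable_not_exists_forall_mem hS) fun g => Iff.rfl)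
  obtain ⟨g, hg⟩ := hM.exists_seq_forall_mem hκ hA T hT
    (by
      rintro ⟨n, Θ⟩ ⟨n', Θ'⟩
      refine ⟨(max n n', ⟨Θ.1 ∩ Θ'.1, Θ.2.1.inter Θ'.2.1, Θ.2.2, Θ'.2.2⟩), ?_, ?_⟩
      · rintro g ⟨h1, h2⟩
        exact ⟨fun i hi => (h1 i (Finset.range_mono (le_max_left _ _) hi)).1,
          fun s hs => h2 s (Finset.powersetCard_mono (Finset.range_mono (le_max_left _ _)) hs)⟩
      · rintro g ⟨h1, h2⟩
        exact ⟨fun i hi => (h1 i (Finset.range_mono (le_max_right _ _) hi)).2,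
          fun s hs => h2 s (Finset.powersetCard_mono (Finset.range_mono (le_max_right _ _)) hs)⟩)
    (by
      rintro ⟨n, Θ⟩
      obtain ⟨d, hd, hk⟩ := h n Θ.1 Θ.2.1 Θ.2.2
      refine ⟨fun q => if hq : q.1 < n then d ⟨q.1, hq⟩ q.2 else c q.2, ?_, ?_⟩
      · intro i hi
        rw [Finset.mem_range] at hi
        have := hd ⟨i, hi⟩
        convert this using 1
        funext z
        exact dif_pos hi
      · rintro s hs ⟨x, hx⟩
        obtain ⟨hsn, hsk⟩ := Finset.mem_powersetCard.1 hs
        have hlt : ∀ i ∈ s, i < n := fun i hi => Finset.mem_range.1 (hsn hi)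
        refine hk (s.attachFin hlt) (by rw [Finset.card_attachFin, hsk]) ⟨x, fun i hi => ?_⟩
        have := hx i (Finset.mem_attachFin hlt |>.1 hi)
        convert this using 2
        funext z
        simp only [i.2, dif_pos])
  refine ⟨k, fun i z => g (i, z), fun i => sameType_of_forall_mem fun Θ hΘ hc => ?_, ?_⟩
  · exact (hg (i + 1, ⟨Θ, hΘ, hc⟩)).1 i (Finset.self_mem_range_succ i)
  · intro s hs
    refine (hg (s.sup id + 1, ⟨Set.univ, Set.definable_univ, trivial⟩)).2 s
      (Finset.mem_powersetCard.2 ⟨fun i hi => ?_, hs⟩)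
    exact Finset.mem_range.2 (Nat.lt_succ_of_le (Finset.le_sup (f := id) hi))

/-- Left transitivity of dividing: if `tp(b/Ac)` does not divide over `A`, then a set `R_c` which
divides over `A` still divides over `Ab` after its first variables are set to `b`. A sequence
witnessing dividing of `R_c` has finite subsequences whose members look, over `b`, like `c`,
since the contrary would be a formula in `tp(b/Ac)` which divides over `A`. -/
theorem DividesAlong.divides_fiber {κ : Cardinal.{w}} (hM : IsSaturated L κ M) (hκ : ℵ₀ < κ)
    {A : Set M} (hA : #A < κ) {ζ η ι : Type} [Finite ζ] [Finite η] [Finite ι]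
    {R : Set (ζ ⊕ (η ⊕ ι) → M)} (hR : A.Definable L R) {c : ζ → M} {b : η → M}
    (h : DividesAlong L A R c)
    (hb : ∀ S : Set (ζ ⊕ η → M), A.Definable L S → Sum.elim c b ∈ S → ¬ DividesAlong L A S c) :
    Divides L (A ∪ Set.range b) (fiber (fiber R c) b) := by
  classical
  obtain ⟨k, d, hd, hk⟩ := h
  let R₁ : Set (η ⊕ (ζ ⊕ ι) → M) := (fun g => g ∘ Sum.elim (Sum.inr ∘ Sum.inl)
    (Sum.elim Sum.inl (Sum.inr ∘ Sum.inr))) ⁻¹' R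
  have hR₁ : A.Definable L R₁ := hR.preimage_comp _
  have hmem : ∀ (y : ζ → M) (x : ι → M),
      Sum.elim y x ∈ fiber R₁ b ↔ Sum.elim y (Sum.elim b x) ∈ R := by
    intro y x
    refine iff_of_eq (congrArg (· ∈ R) (funext ?_))
    rintro (z | z | z) <;> rfl
  have key : DividesAlong L (A ∪ Set.range b) (fiber R₁ b) c := by
    refine hM.dividesAlong hκ (mk_union_range_lt hκ hA b) (definable_fiber hR₁ b) k ?_
    intro n Θ hΘ hc
    obtain ⟨Ψ, hΨ, rfl⟩ := exists_eq_fiber hΘ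
    -- The elements over which there is a sequence of length `n` as wanted.
    let χ : Set (η → M) := {z | ∃ u : Fin n × ζ → M, (∀ i, Sum.elim z (fun y => u (i, y)) ∈ Ψ) ∧
      ∀ s : Finset (Fin n), s.card = k →
        ¬ ∃ x : η ⊕ ι → M, ∀ i ∈ s, Sum.elim (fun y => u (i, y)) x ∈ R}
    have hχ : A.Definable L χ := by
      have h1 : A.Definable L {w : η ⊕ (Fin n × ζ) → M | ∀ i ∈ Finset.univ,
          w ∘ Sum.elim Sum.inl (fun y => Sum.inr (i, y)) ∈ Ψ} :=
        definable_of_mem_iff_finset_forall _ (fun i => hΨ.preimage_comp _) fun w => Iff.rfl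
      have h2 : A.Definable L {u : Fin n × ζ → M | ∀ s ∈ Finset.powersetCard k Finset.univ,
          ¬ ∃ x : η ⊕ ι → M, ∀ i ∈ s, Sum.elim (fun y => u (i, y)) x ∈ R} :=
        definable_of_mem_iff_finset_forall _ (definable_not_exists_forall_mem hR) fun w => Iff.rfl
      refine definable_of_mem_iff_exists (h1.inter (h2.preimage_comp Sum.inr)) fun z => ?_
      refine exists_congr fun u => and_congr ?_ ?_
      · rw [Set.mem_ofPred_eq]
        simp only [Finset.mem_univ, true_imp_iff]
        refine forall_congr' fun i => iff_of_eq (congrArg (· ∈ Ψ) (funext ?_))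
        rintro (y | y) <;> rfl
      · rw [Set.mem_preimage, Set.mem_ofPred_eq]
        simp only [Finset.mem_powersetCard, Finset.subset_univ, true_and, Sum.elim_comp_inr]
    have hbχ : b ∈ χ := by
      by_contra hbχ
      let S : Set (ζ ⊕ η → M) := {w | w ∘ Sum.elim Sum.inr Sum.inl ∈ Ψ} ∩ {w | w ∘ Sum.inr ∈ χᶜ}
      have hS : A.Definable L S := (hΨ.preimage_comp _).inter (hχ.compl.preimage_comp _)
      have hmemS : ∀ y z, Sum.elim y z ∈ S ↔ Sum.elim z y ∈ Ψ ∧ z ∉ χ := by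
        intro y z
        refine and_congr (iff_of_eq (congrArg (· ∈ Ψ) (funext ?_))) Iff.rfl
        rintro (y | y) <;> rfl
      refine hb S hS ((hmemS _ _).2 ⟨hc, hbχ⟩) ⟨n + 1, d, hd, ?_⟩
      rintro s hs ⟨z, hz⟩
      have hne : s.Nonempty := Finset.card_pos.1 (by omega)
      obtain ⟨i₀, hi₀⟩ := hne
      refine ((hmemS _ _).1 (hz i₀ hi₀)).2 ?_
      let f : Fin n ↪ ℕ := Fin.castSuccEmb.trans (s.orderEmbOfFin hs).toEmbedding
      have hf : ∀ i, f i ∈ s := fun i => Finset.orderEmbOfFin_mem s hs _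
      refine ⟨fun q => d (f q.1) q.2, fun i => ((hmemS _ _).1 (hz _ (hf i))).1, ?_⟩
      rintro s' hs' ⟨x, hx⟩
      refine hk (s'.map f) (by rw [Finset.card_map, hs']) ⟨x, fun i hi => ?_⟩
      obtain ⟨j, hj, rfl⟩ := Finset.mem_map.1 hi
      exact hx j hj
    obtain ⟨u, hu, huk⟩ := hbχ
    refine ⟨fun i y => u (i, y), hu, ?_⟩
    rintro s hs ⟨x, hx⟩
    exact huk s hs ⟨Sum.elim b x, fun i hi => (hmem _ _).1 (hx i hi)⟩
  have := key.divides (definable_fiber hR₁ b)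
  convert this using 1
  ext x
  exact (hmem c x).symm

theorem forks_of_subset_biUnion {I : Type*} {ι : Type} {A : Set M} {X : Set (ι → M)}
    {Y : I → Set (ι → M)} (F : Finset I) (hY : ∀ i ∈ F, Divides L A (Y i))
    (hX : ∀ x ∈ X, ∃ i ∈ F, x ∈ Y i) : Forks L A X := by
  refine ⟨F.card, fun j => Y (F.equivFin.symm j), fun j => hY _ (F.equivFin.symm j).2, ?_⟩
  intro x hx
  obtain ⟨i, hi, hxi⟩ := hX x hx
  exact Set.mem_iUnion.2 ⟨F.equivFin ⟨i, hi⟩, by simpa using hxi⟩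

theorem Divides.mono {ι : Type} {A B : Set M} (hAB : A ⊆ B) {X : Set (ι → M)}
    (h : Divides L B X) : Divides L A X := by
  obtain ⟨m, φ, c, hX, k, d, hd, hk⟩ := h
  exact ⟨m, φ, c, hX, k, d, fun i => (hd i).mono hAB, hk⟩

theorem TypeForks.mono {ι : Type} {A A' B : Set M} (hA : A ⊆ A') {a : ι → M}
    (h : TypeForks L A' B a) : TypeForks L A B a := by
  obtain ⟨X, hX, ha, n, Y, hY, hXY⟩ := h
  exact ⟨X, hX, ha, n, Y, fun i => (hY i).mono hA, hXY⟩

theorem TypeForks.congr {ι : Type} {A B : Set M} {a a' : ι → M} (h : TypeForks L A B a)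
    (ha : SameType L B a a') : TypeForks L A B a' := by
  obtain ⟨X, hX, haX, hf⟩ := h
  exact ⟨X, hX, (ha.mem_iff hX).1 haX, hf⟩

theorem Divides.preimage_comp {ι ι' : Type} {A : Set M} {X : Set (ι → M)} (h : Divides L A X)
    (f : ι → ι') : Divides L A ((fun g : ι' → M => g ∘ f) ⁻¹' X) := by
  obtain ⟨m, φ, c, rfl, k, d, hd, hk⟩ := h
  have key : ∀ (c : Fin m → M) (x : ι' → M),
      (φ.relabel (Sum.elim Sum.inl (Sum.inr ∘ f))).Realize (Sum.elim c x) ↔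
        φ.Realize (Sum.elim c (x ∘ f)) := by
    intro c x
    rw [Language.Formula.realize_relabel]
    refine iff_of_eq (congrArg _ (funext ?_))
    rintro (z | z) <;> rfl
  refine ⟨m, φ.relabel (Sum.elim Sum.inl (Sum.inr ∘ f)), c, ?_, k, d, hd, ?_⟩
  · ext x
    exact (key c x).symm
  · rintro s hs ⟨x, hx⟩
    exact hk s hs ⟨x ∘ f, fun i hi => (key _ _).1 (hx i hi)⟩

theorem TypeForks.comp {ι ι' : Type} {A B : Set M} {a : ι → M} (h : TypeForks L A B a)
    {g : ι' → ι} (hg : Function.Surjective g) : TypeForks L A B (a ∘ g) := by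
  obtain ⟨X, hX, ha, n, Y, hY, hXY⟩ := h
  obtain ⟨f, hf⟩ := hg.hasRightInverse
  refine ⟨_, hX.preimage_comp f, ?_, n, _, fun i => (hY i).preimage_comp f, ?_⟩
  · rw [Set.mem_preimage, Function.comp_assoc, hf.comp_eq_id, Function.comp_id]
    exact ha
  · intro x hx
    obtain ⟨i, hi⟩ := Set.mem_iUnion.1 (hXY hx)
    exact Set.mem_iUnion.2 ⟨i, hi⟩

/-- Left transitivity of forking. -/
theorem TypeForks.left_or_right {κ : Cardinal.{w}} (hM : IsSaturated L κ M) (hκ : ℵ₀ < κ)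
    {A C : Set M} (hAC : A ⊆ C) (hC : #C < κ) {η ι : Type} [Finite η] [Finite ι]
    {b : η → M} {a : ι → M} (h : TypeForks L A C (Sum.elim b a)) :
    TypeForks L A C b ∨ TypeForks L (A ∪ Set.range b) (C ∪ Set.range b) a := by
  classical
  rw [or_iff_not_imp_left]
  intro hb
  obtain ⟨X, hX, hbaX, n, Y, hY, hXY⟩ := h
  have hA : #A < κ := (mk_le_mk_of_subset hAC).trans_lt hC
  choose m R c₀ hR hYR hdiv using fun i => (hY i).exists_dividesAlong
  let ζ : Type := Σ i : Fin n, Fin (m i)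
  let e : ∀ i, Fin (m i) → ζ := fun i j => ⟨i, j⟩
  let c : ζ → M := fun q => c₀ q.1 q.2
  -- The parameters are moved, within their type over `C`, so that `tp(b/Cc)` does not divide.
  obtain ⟨c', hc', hbc'⟩ : ∃ c' : ζ → M, SameType L C c' c ∧
      ∀ (i : Fin n) (S : Set (Fin (m i) ⊕ η → M)), A.Definable L S →
        DividesAlong L A S (c ∘ e i) → Sum.elim (c' ∘ e i) b ∉ S := by
    let K := {q : Σ i : Fin n, Set (Fin (m i) ⊕ η → M) //
      A.Definable L q.2 ∧ DividesAlong L A q.2 (c ∘ e q.1)}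
    let I := {Θ : Set (ζ → M) // C.Definable L Θ ∧ c ∈ Θ} × Finset K
    have : Nonempty I := ⟨⟨Set.univ, Set.definable_univ, trivial⟩, ∅⟩
    let V : K → Set (ζ ⊕ η → M) := fun q =>
      (fun g => g ∘ Sum.elim (Sum.inl ∘ e q.1.1) Sum.inr) ⁻¹' q.1.2
    have hV : ∀ q, C.Definable L (V q) := fun q => (q.2.1.mono hAC).preimage_comp _
    have hVmem : ∀ q y z, Sum.elim y z ∈ V q ↔ Sum.elim (y ∘ e q.1.1) z ∈ q.1.2 := by
      intro q y z
      refine iff_of_eq (congrArg (· ∈ q.1.2) (funext ?_))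
      rintro (j | j) <;> rfl
    let T : I → Set (ζ → M) := fun q => q.1.1 ∩ {y | ∀ s ∈ q.2, Sum.elim y b ∉ V s}
    have hT : ∀ q, (C ∪ Set.range b).Definable L (T q) := by
      intro q
      refine (q.1.2.1.mono Set.subset_union_left).inter
        (definable_of_mem_iff_finset_forall q.2 (fun s => Set.Definable.compl
          (definable_fiber ((hV s).preimage_comp (Sum.elim Sum.inr Sum.inl)) b)) fun y => ?_)
      refine forall₂_congr fun s _ => not_congr (iff_of_eq (congrArg (· ∈ V s) (funext ?_)))
      rintro (j | j) <;> rfl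
    obtain ⟨c', hc'⟩ := hM.exists_forall_mem (mk_union_range_lt hκ hC b) T hT
      (by
        rintro ⟨Θ, F⟩ ⟨Θ', F'⟩
        refine ⟨(⟨Θ.1 ∩ Θ'.1, Θ.2.1.inter Θ'.2.1, Θ.2.2, Θ'.2.2⟩, F ∪ F'), ?_, ?_⟩
        · rintro y ⟨h1, h2⟩
          exact ⟨h1.1, fun s hs => h2 s (Finset.mem_union_left _ hs)⟩
        · rintro y ⟨h1, h2⟩
          exact ⟨h1.2, fun s hs => h2 s (Finset.mem_union_right _ hs)⟩)
      (by
        rintro ⟨Θ, F⟩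
        by_contra hne
        have hall : ∀ y ∈ Θ.1, ∃ s ∈ F, Sum.elim y b ∈ V s := by
          intro y hy
          by_contra hcon
          push Not at hcon
          exact hne ⟨y, hy, hcon⟩
        have hZ : C.Definable L {z : η → M | ∀ y : ζ → M,
            y ∈ Θ.1 → ∃ s ∈ F, Sum.elim y z ∈ V s} := by
          have hW : C.Definable L {w : η ⊕ ζ → M | ∃ s ∈ F,
              w ∘ Sum.elim Sum.inr Sum.inl ∈ V s} :=
            definable_of_mem_iff_finset_exists F
              (fun s => (hV s).preimage_comp (Sum.elim Sum.inr Sum.inl)) fun w => Iff.rfl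
          refine definable_of_mem_iff_forall
            ((Θ.2.1.preimage_comp (Sum.inr : ζ → η ⊕ ζ)).compl.union hW) fun z => ?_
          refine forall_congr' fun y => imp_iff_not_or.trans (or_congr Iff.rfl ?_)
          refine exists_congr fun s => and_congr_right fun _ =>
            iff_of_eq (congrArg (· ∈ V s) (funext ?_))
          rintro (j | j) <;> rfl
        refine hb ⟨_, hZ, hall, forks_of_subset_biUnion (Y := fun s : K =>
          fiber s.1.2 (c ∘ e s.1.1)) F (fun s _ => s.2.2.divides s.2.1) ?_⟩
        intro z hz
        obtain ⟨s, hs, hsz⟩ := hz c Θ.2.2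
        exact ⟨s, hs, (hVmem s c z).1 hsz⟩)
    refine ⟨c', sameType_of_forall_mem fun Θ hΘ hc => (hc' (⟨Θ, hΘ, hc⟩, ∅)).1, ?_⟩
    intro i S hS hSc hmem
    exact (hc' (⟨Set.univ, Set.definable_univ, trivial⟩, {⟨⟨i, S⟩, hS, hSc⟩})).2 _
      (Finset.mem_singleton_self _) ((hVmem _ _ _).2 hmem)
  have hci : ∀ i, SameType L A (c₀ i) (c' ∘ e i) := fun i =>
    ((hc'.symm.mono hAC).comp (e i))
  have hX' : ∀ x ∈ X, ∃ i ∈ Finset.univ, Sum.elim (c' ∘ e i) x ∈ R i := by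
    have hW : C.Definable L {y : ζ → M | ∀ x : η ⊕ ι → M, x ∈ X →
        ∃ i ∈ Finset.univ, Sum.elim (y ∘ e i) x ∈ R i} := by
      have hW' : C.Definable L {w : ζ ⊕ (η ⊕ ι) → M | ∃ i ∈ Finset.univ,
          w ∘ Sum.elim (Sum.inl ∘ e i) Sum.inr ∈ R i} :=
        definable_of_mem_iff_finset_exists Finset.univ
          (fun i => ((hR i).mono hAC).preimage_comp
            (Sum.elim (Sum.inl ∘ e i) (Sum.inr : η ⊕ ι → ζ ⊕ (η ⊕ ι)))) fun w => Iff.rfl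
      refine definable_of_mem_iff_forall
        ((hX.preimage_comp (Sum.inr : η ⊕ ι → ζ ⊕ (η ⊕ ι))).compl.union hW') fun z => ?_
      refine forall_congr' fun y => imp_iff_not_or.trans (or_congr Iff.rfl ?_)
      refine exists_congr fun s => and_congr_right fun _ =>
        iff_of_eq (congrArg (· ∈ R s) (funext ?_))
      rintro (j | j) <;> rfl
    refine (hc'.mem_iff hW).2 fun x hx => ?_
    obtain ⟨i, hi⟩ := Set.mem_iUnion.1 (hXY hx)
    rw [hYR] at hi
    exact ⟨i, Finset.mem_univ _, hi⟩
  refine ⟨fiber X b, definable_fiber hX b, hbaX, forks_of_subset_biUnion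
    (Y := fun i => fiber (fiber (R i) (c' ∘ e i)) b) Finset.univ (fun i _ => ?_)
    fun x hx => hX' _ hx⟩
  exact ((hdiv i).congr (hci i)).divides_fiber hM hκ hA (hR i)
    fun S hS hSb hSc => hbc' i S hS (hSc.congr (hci i).symm) hSb

/-! ### Lascar rank -/

theorem lascarRankGE_iff {κ : Cardinal.{w}} {ι : Type} {α : Ordinal.{w}} {A : Set M}
    {a : ι → M} : LascarRankGE L κ α A a ↔ ∀ β < α, ∃ (B : Set M) (a' : ι → M), A ⊆ B ∧ #B < κ ∧
      SameType L A a' a ∧ TypeForks L A B a' ∧ LascarRankGE L κ β B a' := by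
  rw [LascarRankGE]

theorem lascarRankGE_zero {κ : Cardinal.{w}} {ι : Type} (A : Set M) (a : ι → M) :
    LascarRankGE L κ (0 : ℕ) A a := by
  rw [lascarRankGE_iff, Nat.cast_zero]
  exact fun β hβ => absurd hβ not_lt_zero

namespace LascarRankGE

variable {κ : Cardinal.{w}} {ι : Type} {α β : Ordinal.{w}} {A B : Set M} {a a' : ι → M}

theorem of_le (h : LascarRankGE L κ α A a) (hβ : β ≤ α) : LascarRankGE L κ β A a := by
  rw [lascarRankGE_iff] at h ⊢
  exact fun γ hγ => h γ (hγ.trans_le hβ)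

theorem congr (h : LascarRankGE L κ α A a) (ha : SameType L A a a') :
    LascarRankGE L κ α A a' := by
  rw [lascarRankGE_iff] at h ⊢
  intro γ hγ
  obtain ⟨B, a'', hAB, hB, hs, hf, hr⟩ := h γ hγ
  exact ⟨B, a'', hAB, hB, hs.trans ha, hf, hr⟩

theorem mono (h : LascarRankGE L κ α B a) (hAB : A ⊆ B) : LascarRankGE L κ α A a := by
  rw [lascarRankGE_iff] at h ⊢
  intro γ hγ
  obtain ⟨C, a', hBC, hC, hs, hf, hr⟩ := h γ hγ
  exact ⟨C, a', hAB.trans hBC, hC, hs.mono hAB, hf.mono hAB, hr⟩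

theorem comp {ι' : Type} {g : ι' → ι} (hg : Function.Surjective g)
    (h : LascarRankGE L κ α A a) : LascarRankGE L κ α A (a ∘ g) := by
  induction α using WellFoundedLT.induction generalizing A a with
  | ind α ih =>
    rw [lascarRankGE_iff] at h ⊢
    intro γ hγ
    obtain ⟨C, a', hBC, hC, hs, hf, hr⟩ := h γ hγ
    exact ⟨C, a' ∘ g, hBC, hC, hs.comp g, hf.comp hg, ih γ hγ hr⟩

theorem natCast_succ {n : ℕ} (hAB : A ⊆ B) (hB : #B < κ) (ha : SameType L A a' a)
    (hf : TypeForks L A B a') (h : LascarRankGE L κ n B a') :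
    LascarRankGE L κ (n + 1 : ℕ) A a := by
  rw [lascarRankGE_iff]
  intro γ hγ
  refine ⟨B, a', hAB, hB, ha, hf, h.of_le ?_⟩
  rwa [Nat.cast_succ, Order.lt_add_one_iff] at hγ

/-- The inequality `U(ba/A) ≤ U(b/A) + U(a/Ab)` of Lascar, for finite ranks. By left
transitivity, whenever the type of `ba` forks, the type of `b` or that of `a` over `b` does. -/
theorem exists_add_eq {η : Type} [Finite η] [Finite ι] (hM : IsSaturated L κ M) (hκ : ℵ₀ < κ)
    (n : ℕ) {b : η → M} (h : LascarRankGE L κ n A (Sum.elim b a)) :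
    ∃ (b' : η → M) (a' : ι → M) (i j : ℕ), SameType L A (Sum.elim b' a') (Sum.elim b a) ∧
      i + j = n ∧ LascarRankGE L κ i A b' ∧ LascarRankGE L κ j (A ∪ Set.range b') a' := by
  induction n generalizing A a b with
  | zero =>
    exact ⟨b, a, 0, 0, SameType.refl _, rfl, lascarRankGE_zero _ _, lascarRankGE_zero _ _⟩
  | succ n ih =>
    obtain ⟨B, ba, hAB, hB, hs, hf, hr⟩ :=
      lascarRankGE_iff.1 h n (by exact_mod_cast Nat.lt_succ_self n)
    rw [← Sum.elim_comp_inl_inr ba] at hs hf hr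
    obtain ⟨b', a', i, j, hs', hij, hi, hj⟩ := ih hr
    refine ⟨b', a', ?_⟩
    rcases (hf.congr hs'.symm).left_or_right hM hκ hAB hB with hfb | hfa
    · exact ⟨i + 1, j, (hs'.mono hAB).trans hs, by omega,
        hi.natCast_succ hAB hB (SameType.refl _) hfb, hj.mono (Set.union_subset_union_left _ hAB)⟩
    · exact ⟨i, j + 1, (hs'.mono hAB).trans hs, by omega, hi.mono hAB,
        hj.natCast_succ (Set.union_subset_union_left _ hAB) (mk_union_range_lt hκ hB b')
          (SameType.refl _) hfa⟩

end LascarRankGE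

/-! ### Morley rank -/

theorem morleyRankGE_iff {ι : Type} {α : Ordinal.{w}} {X : Set (ι → M)} :
    MorleyRankGE L α X ↔ X.Nonempty ∧ ∀ β < α, ∃ D : ℕ → Set (ι → M),
      (∀ i, Set.univ.Definable L (D i) ∧ D i ⊆ X ∧ MorleyRankGE L β (D i)) ∧
      ∀ i j, i ≠ j → Disjoint (D i) (D j) := by
  rw [MorleyRankGE]

theorem morleyRankGE_zero_iff {ι : Type} {X : Set (ι → M)} :
    MorleyRankGE L (0 : ℕ) X ↔ X.Nonempty := by
  rw [morleyRankGE_iff, Nat.cast_zero]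
  exact and_iff_left fun β hβ => absurd hβ not_lt_zero

namespace MorleyRankGE

variable {ι : Type} {α β : Ordinal.{w}} {X Y : Set (ι → M)}

theorem nonempty (h : MorleyRankGE L α X) : X.Nonempty := (morleyRankGE_iff.1 h).1

theorem of_le (h : MorleyRankGE L α X) (hβ : β ≤ α) : MorleyRankGE L β X := by
  rw [morleyRankGE_iff] at h ⊢
  exact ⟨h.1, fun γ hγ => h.2 γ (hγ.trans_le hβ)⟩

theorem mono (h : MorleyRankGE L α X) (hXY : X ⊆ Y) : MorleyRankGE L α Y := by
  rw [morleyRankGE_iff] at h ⊢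
  refine ⟨h.1.mono hXY, fun γ hγ => ?_⟩
  obtain ⟨D, hD, hdis⟩ := h.2 γ hγ
  exact ⟨D, fun i => ⟨(hD i).1, (hD i).2.1.trans hXY, (hD i).2.2⟩, hdis⟩

theorem natCast_succ {n : ℕ} (D : ℕ → Set (ι → M)) (hdef : ∀ i, Set.univ.Definable L (D i))
    (hsub : ∀ i, D i ⊆ X) (hD : ∀ i, MorleyRankGE L n (D i))
    (hdis : ∀ i j, i ≠ j → Disjoint (D i) (D j)) : MorleyRankGE L (n + 1 : ℕ) X := by
  rw [morleyRankGE_iff]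
  refine ⟨(hD 0).nonempty.mono (hsub 0), fun γ hγ => ⟨D, fun i => ⟨hdef i, hsub i, ?_⟩, hdis⟩⟩
  rw [Nat.cast_succ, Order.lt_add_one_iff] at hγ
  exact (hD i).of_le hγ

theorem exists_disjoint {n : ℕ} (h : MorleyRankGE L (n + 1 : ℕ) X) : ∃ D : ℕ → Set (ι → M),
    (∀ i, Set.univ.Definable L (D i) ∧ D i ⊆ X ∧ MorleyRankGE L n (D i)) ∧
      ∀ i j, i ≠ j → Disjoint (D i) (D j) :=
  (morleyRankGE_iff.1 h).2 n (by exact_mod_cast Nat.lt_succ_self n)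

/-- `MR(S × T) ≥ MR(S) + MR(T)`, for finite ranks, and with the product in variables `γ` which are
the disjoint union of those of `S` and `T`. -/
theorem prod {η γ : Type} (e : ι ⊕ η ≃ γ) {S : Set (ι → M)} {T : Set (η → M)}
    (hS : Set.univ.Definable L S) (hT : Set.univ.Definable L T) {i j : ℕ}
    (hi : MorleyRankGE L i S) (hj : MorleyRankGE L j T) :
    MorleyRankGE L (i + j : ℕ)
      {w : γ → M | w ∘ (e ∘ Sum.inl) ∈ S ∧ w ∘ (e ∘ Sum.inr) ∈ T} := by
  induction i generalizing S with
  | zero =>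
    induction j generalizing T with
    | zero =>
      obtain ⟨s, hs⟩ := hi.nonempty
      obtain ⟨t, ht⟩ := hj.nonempty
      refine morleyRankGE_zero_iff.2 ⟨Sum.elim s t ∘ e.symm, ?_, ?_⟩
      · convert hs using 1
        funext z
        simp
      · convert ht using 1
        funext z
        simp
    | succ j ih =>
      obtain ⟨D, hD, hdis⟩ := hj.exists_disjoint
      rw [← add_assoc]
      refine natCast_succ _ (fun l => (hS.preimage_comp (e ∘ Sum.inl)).inter
        ((hD l).1.preimage_comp (e ∘ Sum.inr))) (fun l w hw => ⟨hw.1, (hD l).2.1 hw.2⟩)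
        (fun l => ih (hD l).1 (hD l).2.2) fun l l' hl => ?_
      exact Set.disjoint_left.2 fun w hw hw' =>
        Set.disjoint_left.1 (hdis l l' hl) hw.2 hw'.2
  | succ i ih =>
    obtain ⟨D, hD, hdis⟩ := hi.exists_disjoint
    rw [Nat.add_right_comm]
    refine natCast_succ _ (fun l => ((hD l).1.preimage_comp (e ∘ Sum.inl)).inter
      (hT.preimage_comp (e ∘ Sum.inr))) (fun l w hw => ⟨(hD l).2.1 hw.1, hw.2⟩)
      (fun l => ih (hD l).1 (hD l).2.2) fun l l' hl => ?_
    exact Set.disjoint_left.2 fun w hw hw' =>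
      Set.disjoint_left.1 (hdis l l' hl) hw.1 hw'.1

end MorleyRankGE

/-- The power `X^N`, with the `N` tuples indexed by `Fin N`. -/
def power {ι : Type} (N : ℕ) (X : Set (ι → M)) : Set (Fin N × ι → M) :=
  {w | ∀ j, w ∘ Prod.mk j ∈ X}

theorem definable_power {ι : Type} {A : Set M} {X : Set (ι → M)} (hX : A.Definable L X) (N : ℕ) :
    A.Definable L (power N X) :=
  definable_of_mem_iff_finset_forall Finset.univ (fun j => hX.preimage_comp (Prod.mk j))
    fun w => by simp [power]

/-- The last tuple of `N + 1` tuples is split off. -/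
def finSuccProdEquiv (N : ℕ) (ι : Type) : (Fin N × ι) ⊕ ι ≃ Fin (N + 1) × ι where
  toFun := Sum.elim (fun q => (q.1.castSucc, q.2)) (fun z => (Fin.last N, z))
  invFun q := Fin.lastCases (motive := fun _ => (Fin N × ι) ⊕ ι) (Sum.inr q.2)
    (fun j => Sum.inl (j, q.2)) q.1
  left_inv := by rintro (q | z) <;> simp
  right_inv := by
    rintro ⟨j, z⟩
    induction j using Fin.lastCases <;> simp

theorem mem_power_succ {ι : Type} {N : ℕ} {X : Set (ι → M)} {w : Fin (N + 1) × ι → M} :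
    w ∈ power (N + 1) X ↔ w ∘ (finSuccProdEquiv N ι ∘ Sum.inl) ∈ power N X ∧
      w ∘ (finSuccProdEquiv N ι ∘ Sum.inr) ∈ X :=
  ⟨fun h => ⟨fun j => h j.castSucc, h (Fin.last N)⟩,
    fun h j => Fin.lastCases h.2 (fun j => h.1 j) j⟩

theorem MorleyRankGE.power {ι : Type} {X : Set (ι → M)} (hX : Set.univ.Definable L X) {d : ℕ}
    (h : MorleyRankGE L d X) (N : ℕ) : MorleyRankGE L (N * d : ℕ) (power N X) := by
  induction N with
  | zero =>
    rw [Nat.zero_mul, morleyRankGE_zero_iff]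
    exact ⟨fun q => q.1.elim0, fun j => j.elim0⟩
  | succ N ih =>
    rw [Nat.succ_mul]
    exact (ih.prod (finSuccProdEquiv N ι) (definable_power hX N) hX h).mono
      fun w hw => mem_power_succ.2 hw

theorem MorleyRankGE.of_fiber {η ι : Type} {E : Set (η ⊕ ι → M)} (hE : Set.univ.Definable L E)
    [Finite η] {b : η → M} {d : ℕ} (h : MorleyRankGE L d (fiber E b)) : MorleyRankGE L d E := by
  have hb : Set.univ.Definable L ({b} : Set (η → M)) := by
    have : Fintype η := Fintype.ofFinite η
    refine definable_of_mem_iff_finset_forall (S := fun j => {g : η → M | g j = b j})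
      Finset.univ (fun j => ?_) fun g => ?_
    · exact definable_of_mem_iff_comp (S := {x : Fin 1 → M | x 0 ∈ ({b j} : Set M)})
        (Set.Definable.singleton_of_mem L (Set.mem_univ _)) (fun _ => j) fun g => Iff.rfl
    · simp [funext_iff]
  have := (morleyRankGE_zero_iff (L := L).2 (Set.singleton_nonempty b)).prod (Equiv.refl _) hb
    ((definable_fiber hE b).mono (Set.subset_univ _)) h
  rw [Nat.zero_add] at this
  refine this.mono fun w hw => ?_
  obtain ⟨h1, h2⟩ := hw
  rw [← Sum.elim_comp_inl_inr w, show w ∘ Sum.inl = b from h1]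
  exact h2

/-! ### Automorphisms -/

theorem mem_iff_comp_mem {A : Set M} {α : Type*} {X : Set (α → M)} (hX : A.Definable L X)
    (σ : M ≃[L] M) (hσ : ∀ a ∈ A, σ a = a) (g : α → M) : g ∈ X ↔ σ ∘ g ∈ X := by
  obtain ⟨φ, rfl⟩ := Set.definable_iff_exists_formula_sum.1 hX
  rw [Set.mem_ofPred_eq, Set.mem_ofPred_eq, ← Language.StrongHomClass.realize_formula σ φ]
  refine iff_of_eq (congrArg _ (funext ?_))
  rintro (a | i)
  · exact hσ a a.2
  · rfl

theorem definable_preimage_equiv {α : Type*} {X : Set (α → M)} (hX : Set.univ.Definable L X)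
    (σ : M ≃[L] M) : Set.univ.Definable L ((fun g : α → M => σ ∘ g) ⁻¹' X) := by
  obtain ⟨φ, rfl⟩ := Set.definable_iff_exists_formula_sum.1 hX
  refine Set.definable_iff_exists_formula_sum.2
    ⟨φ.relabel (Sum.map (fun a : (Set.univ : Set M) =>
      (⟨σ.symm a, trivial⟩ : (Set.univ : Set M))) id), ?_⟩
  ext g
  rw [Set.mem_preimage, Set.mem_ofPred_eq, Set.mem_ofPred_eq, Language.Formula.realize_relabel]
  refine Iff.trans (iff_of_eq (congrArg _ (funext ?_)))
    (Language.StrongHomClass.realize_formula σ φ)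
  rintro (a | i)
  · exact (σ.apply_symm_apply a).symm
  · rfl

theorem MorleyRankGE.preimage_equiv {ι : Type} {α : Ordinal.{w}} {X : Set (ι → M)}
    (h : MorleyRankGE L α X) (σ : M ≃[L] M) :
    MorleyRankGE L α ((fun g : ι → M => σ ∘ g) ⁻¹' X) := by
  induction α using WellFoundedLT.induction generalizing X with
  | ind α ih =>
    rw [morleyRankGE_iff] at h ⊢
    obtain ⟨⟨x, hx⟩, h⟩ := h
    refine ⟨⟨σ.symm ∘ x, ?_⟩, fun β hβ => ?_⟩
    · rw [Set.mem_preimage, show σ ∘ σ.symm ∘ x = x from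
        funext fun i => σ.apply_symm_apply (x i)]
      exact hx
    · obtain ⟨D, hD, hdis⟩ := h β hβ
      exact ⟨fun i => (fun g : ι → M => σ ∘ g) ⁻¹' D i, fun i =>
        ⟨definable_preimage_equiv (hD i).1 σ, Set.preimage_mono (hD i).2.1, ih β hβ (hD i).2.2⟩,
        fun i j hij => (hdis i j hij).preimage _⟩

/-- Tuples of the same type over a small set `A` are conjugate under an automorphism fixing `A`. -/
theorem IsMonster.exists_equiv {κ : Cardinal.{w}} (hM : IsMonster L κ M) {A : Set M} (hA : #A < κ)
    {η : Type} [Finite η] {b b' : η → M} (h : SameType L A b b') :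
    ∃ σ : M ≃[L] M, (∀ a ∈ A, σ a = a) ∧ σ ∘ b = b' := by
  classical
  have key : ∀ z : ↥(A ∪ Set.range b), ∃ t : A ⊕ η, Sum.elim (fun a : A => (a : M)) b t = z := by
    rintro ⟨z, hz | ⟨j, rfl⟩⟩
    · exact ⟨Sum.inl ⟨z, hz⟩, rfl⟩
    · exact ⟨Sum.inr j, rfl⟩
  choose t ht using key
  have hreal : ∀ {γ : Type w} (ψ : L.Formula γ) (s : γ → A ⊕ η),
      ψ.Realize (Sum.elim (fun a : A => (a : M)) b ∘ s) ↔
        ψ.Realize (Sum.elim (fun a : A => (a : M)) b' ∘ s) := by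
    intro γ ψ s
    rw [← Language.Formula.realize_relabel, ← Language.Formula.realize_relabel]
    exact h.mem_iff (Set.definable_iff_exists_formula_sum.2 ⟨ψ.relabel s, rfl⟩)
  obtain ⟨σ, hσ⟩ := hM.homogeneous _ (mk_union_range_lt hM.aleph0_lt hA b)
    (Sum.elim (fun a : A => (a : M)) b' ∘ t) (fun φ => by
      rw [← hreal φ t]
      exact iff_of_eq (congrArg _ (funext fun z => (ht z).symm)))
  -- The value of the partial map does not depend on the chosen representatives.
  have heq : ∀ s : A ⊕ η, σ (Sum.elim (fun a : A => (a : M)) b s) =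
      Sum.elim (fun a : A => (a : M)) b' s := by
    intro s
    have hs : Sum.elim (fun a : A => (a : M)) b s ∈ A ∪ Set.range b := by
      rcases s with a | j
      · exact Or.inl a.2
      · exact Or.inr ⟨j, rfl⟩
    have h1 := hσ ⟨_, hs⟩
    rw [h1]
    have := hreal (γ := ULift Bool)
      ((Language.Term.var ⟨true⟩).equal (Language.Term.var ⟨false⟩))
      (fun x => if x.down then t ⟨_, hs⟩ else s)
    simp only [Language.Formula.realize_equal, Language.Term.realize_var, Function.comp_apply,
      if_true, Bool.false_eq_true, if_false] at this
    exact this.1 (ht _)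
  exact ⟨σ, fun a ha => heq (Sum.inl ⟨a, ha⟩), funext fun j => heq (Sum.inr j)⟩

theorem MorleyRankGE.fiber_congr {κ : Cardinal.{w}} (hM : IsMonster L κ M) {A : Set M}
    (hA : #A < κ) {η ι : Type} [Finite η] {E : Set (η ⊕ ι → M)} (hE : A.Definable L E)
    {b b' : η → M} (hb : SameType L A b b') {α : Ordinal.{w}}
    (h : MorleyRankGE L α (fiber E b')) : MorleyRankGE L α (fiber E b) := by
  obtain ⟨σ, hσ, rfl⟩ := hM.exists_equiv hA hb
  refine (h.preimage_equiv σ).mono fun x hx => ?_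
  rw [mem_fiber, mem_iff_comp_mem hE σ hσ, Sum.comp_elim]
  exact hx

/-! ### Values of ranks -/

theorem ofOrdinal_le_ofOrdinal {α β : Ordinal.{w}} : ofOrdinal α ≤ ofOrdinal β ↔ α ≤ β := by
  rw [ofOrdinal, ofOrdinal, WithBot.coe_le_coe, WithTop.coe_le_coe]

theorem ofOrdinal_lt_ofOrdinal {α β : Ordinal.{w}} : ofOrdinal α < ofOrdinal β ↔ α < β := by
  rw [ofOrdinal, ofOrdinal, WithBot.coe_lt_coe, WithTop.coe_lt_coe]

theorem natCast_succ_le_iff {n : ℕ} {r : RankValue.{w}} :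
    ofOrdinal (n + 1 : ℕ) ≤ r ↔ ofOrdinal n < r := by
  induction r using WithBot.recBotCoe with
  | bot => simp [ofOrdinal]
  | coe r =>
    induction r using WithTop.recTopCoe with
    | top => exact iff_of_true (by simp [ofOrdinal]) (WithBot.coe_lt_coe.2 (WithTop.coe_lt_top _))
    | coe α =>
      change ofOrdinal _ ≤ ofOrdinal α ↔ ofOrdinal _ < ofOrdinal α
      rw [ofOrdinal_le_ofOrdinal, ofOrdinal_lt_ofOrdinal, Nat.cast_succ, Order.add_one_le_iff]

/-- Suprema of rank values which are at least a given natural number are so because one of the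
elements is. -/
theorem natCast_le_sSup_iff {n : ℕ} {s : Set RankValue.{w}} :
    ofOrdinal (n : ℕ) ≤ sSup s ↔ ∃ r ∈ s, ofOrdinal (n : ℕ) ≤ r := by
  cases n with
  | zero =>
    have h0 : ∀ r : RankValue.{w}, ofOrdinal (0 : ℕ) ≤ r ↔ ⊥ < r := by
      intro r
      induction r using WithBot.recBotCoe with
      | bot => simp [ofOrdinal]
      | coe r =>
        rw [ofOrdinal, WithBot.coe_le_coe]
        exact iff_of_true (by simp) (WithBot.bot_lt_coe _)
    simp only [h0, lt_sSup_iff]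
  | succ n => simp only [natCast_succ_le_iff, lt_sSup_iff]

theorem natCast_le_morleyRank_iff {ι : Type} {X : Set (ι → M)} {n : ℕ} :
    ofOrdinal (n : ℕ) ≤ morleyRank L X ↔ MorleyRankGE L n X := by
  rw [morleyRank, natCast_le_sSup_iff]
  constructor
  · rintro ⟨r, ⟨α, hα, rfl⟩, h⟩
    exact hα.of_le (ofOrdinal_le_ofOrdinal.1 h)
  · exact fun h => ⟨_, ⟨n, h, rfl⟩, le_rfl⟩

theorem natCast_le_lascarRankType_iff {κ : Cardinal.{w}} {ι : Type} {A : Set M} {a : ι → M}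
    {n : ℕ} : ofOrdinal (n : ℕ) ≤ lascarRankType L κ A a ↔ LascarRankGE L κ n A a := by
  rw [lascarRankType, natCast_le_sSup_iff]
  constructor
  · rintro ⟨r, ⟨α, hα, rfl⟩, h⟩
    exact hα.of_le (ofOrdinal_le_ofOrdinal.1 h)
  · exact fun h => ⟨_, ⟨n, h, rfl⟩, le_rfl⟩

theorem natCast_le_lascarRank_iff {κ : Cardinal.{w}} {ι : Type} {A : Set M} {X : Set (ι → M)}
    {n : ℕ} : ofOrdinal (n : ℕ) ≤ lascarRank L κ A X ↔ ∃ a ∈ X, LascarRankGE L κ n A a := by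
  rw [lascarRank, ← sSup_image, natCast_le_sSup_iff]
  simp only [Set.exists_mem_image, natCast_le_lascarRankType_iff]

theorem MorleyEqLascar.morleyRankGE_iff {κ : Cardinal.{w}} (h : MorleyEqLascar L κ M) {ι : Type}
    [Finite ι] {A : Set M} (hA : #A < κ) {X : Set (ι → M)} (hX : A.Definable L X) {n : ℕ} :
    MorleyRankGE L n X ↔ ∃ a ∈ X, LascarRankGE L κ n A a := by
  rw [← natCast_le_morleyRank_iff, h ι A hA X hX, natCast_le_lascarRank_iff]

theorem morleyRank_le_of_not_morleyRankGE_succ {ι ι' : Type} {X : Set (ι → M)} {Y : Set (ι' → M)} {d : ℕ}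
    (hX : ¬ MorleyRankGE L (d + 1 : ℕ) X) (hY : MorleyRankGE L d Y) :
    morleyRank L X ≤ morleyRank L Y := by
  refine sSup_le ?_
  rintro _ ⟨α, hα, rfl⟩
  refine le_trans ?_ (natCast_le_morleyRank_iff.2 hY)
  rw [ofOrdinal_le_ofOrdinal]
  by_contra hlt
  rw [not_le] at hlt
  refine hX (hα.of_le ?_)
  rwa [Nat.cast_succ, Order.add_one_le_iff]

/-! ### Bounds on Lascar rank -/

/-- If `MR(X) ≤ d` then tuples in `X^N` have Lascar rank at most `N * d`. -/
theorem le_of_lascarRankGE_of_mem_power {κ : Cardinal.{w}} (hM : IsMonster L κ M)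
    (heq : MorleyEqLascar L κ M) {A : Set M} (hA : #A < κ) {ι : Type} [Finite ι]
    {X : Set (ι → M)} (hX : A.Definable L X) {d : ℕ} (hd : ¬ MorleyRankGE L (d + 1 : ℕ) X)
    {N n : ℕ} {a : Fin N × ι → M} (ha : a ∈ power N X) (h : LascarRankGE L κ n A a) :
    n ≤ N * d := by
  induction N generalizing n with
  | zero =>
    by_contra hn
    have h1 : MorleyRankGE L (0 + 1 : ℕ) (Set.univ : Set (Fin 0 × ι → M)) :=
      (heq.morleyRankGE_iff hA Set.definable_univ).2
        ⟨a, trivial, h.of_le (by exact_mod_cast (by omega : 0 + 1 ≤ n))⟩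
    obtain ⟨D, hD, hdis⟩ := h1.exists_disjoint
    obtain ⟨x, hx⟩ := (hD 0).2.2.nonempty
    obtain ⟨y, hy⟩ := (hD 1).2.2.nonempty
    rw [Subsingleton.elim y x] at hy
    exact Set.disjoint_left.1 (hdis 0 1 zero_ne_one) hx hy
  | succ N ih =>
    have h' := h.comp (finSuccProdEquiv N ι).surjective
    rw [← Sum.elim_comp_inl_inr (a ∘ finSuccProdEquiv N ι)] at h'
    obtain ⟨b', a', i, j, hs, hij, hi, hj⟩ := h'.exists_add_eq hM.saturated hM.aleph0_lt n
    rw [mem_power_succ] at ha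
    have hb' : b' ∈ power N X := ((hs.comp Sum.inl).mem_iff (definable_power hX N)).2 ha.1
    have ha' : a' ∈ X := ((hs.comp Sum.inr).mem_iff hX).2 ha.2
    have hid := ih hb' hi
    have hjd : j ≤ d := by
      by_contra hjd
      refine hd ((heq.morleyRankGE_iff (mk_union_range_lt hM.aleph0_lt hA b')
        (hX.mono Set.subset_union_left)).2 ⟨a', ha', hj.of_le ?_⟩)
      exact_mod_cast (by omega : d + 1 ≤ j)
    rw [Nat.succ_mul]
    omega

theorem exists_forall_lascarRankGE_le {κ : Cardinal.{w}} (hM : IsMonster L κ M)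
    (hfin : HasFiniteMorleyRank L M) (heq : MorleyEqLascar L κ M) (η : Type) [Finite η] :
    ∃ m : ℕ, ∀ (A : Set M) (a : η → M) (n : ℕ), #A < κ → LascarRankGE L κ n A a → n ≤ m := by
  obtain ⟨r, hr⟩ := hfin
  have hr' : ¬ MorleyRankGE L (r + 1 : ℕ) (Set.univ : Set (Fin 1 → M)) := by
    rw [← natCast_le_morleyRank_iff, hr, ofOrdinal_le_ofOrdinal, Nat.cast_le]
    omega
  obtain ⟨N, ⟨e⟩⟩ := Finite.exists_equiv_fin η
  refine ⟨N * r, fun A a n hA h => ?_⟩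
  have h' := h.comp (g := e.symm ∘ (Prod.fst : Fin N × Fin 1 → Fin N))
    (e.symm.surjective.comp Prod.fst_surjective)
  exact le_of_lascarRankGE_of_mem_power hM heq hA Set.definable_univ hr' (fun _ => trivial) h'

/-! ### Families of definable sets -/

/-- The restriction to `B` of the family with fibres `(E_b)^N`. -/
def powerFamily {ι η : Type} (N : ℕ) (E : Set (η ⊕ ι → M)) (B : Set (η → M)) :
    Set (η ⊕ (Fin N × ι) → M) :=
  {w | w ∘ Sum.inl ∈ B ∧ w ∘ Sum.inr ∈ power N (fiber E (w ∘ Sum.inl))}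

theorem definable_powerFamily {ι η : Type} {A : Set M} {E : Set (η ⊕ ι → M)} {B : Set (η → M)}
    (hE : A.Definable L E) (hB : A.Definable L B) (N : ℕ) :
    A.Definable L (powerFamily N E B) := by
  refine (hB.preimage_comp Sum.inl).inter (definable_of_mem_iff_finset_forall Finset.univ
    (fun j => hE.preimage_comp (Sum.elim Sum.inl (fun i => Sum.inr (j, i)))) fun w => ?_)
  simp only [Finset.mem_univ, true_imp_iff]
  refine forall_congr' fun j => iff_of_eq (congrArg (· ∈ E) (funext ?_))
  rintro (i | i) <;> rfl

theorem powerFamily_mono {ι η : Type} (N : ℕ) (E : Set (η ⊕ ι → M)) {B B' : Set (η → M)}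
    (h : B ⊆ B') : powerFamily N E B ⊆ powerFamily N E B' := fun _ hw => ⟨h hw.1, hw.2⟩

theorem fiber_powerFamily {ι η : Type} (N : ℕ) (E : Set (η ⊕ ι → M)) {B : Set (η → M)}
    {b : η → M} (hb : b ∈ B) : fiber (powerFamily N E B) b = power N (fiber E b) :=
  Set.ext fun _ => and_iff_right hb

theorem morleyRankGE_powerFamily {ι η : Type} [Finite η] {E : Set (η ⊕ ι → M)} {B : Set (η → M)}
    (hE : Set.univ.Definable L E) (hB : Set.univ.Definable L B) (N : ℕ) {b : η → M} (hb : b ∈ B)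
    {d : ℕ} (h : MorleyRankGE L d (fiber E b)) :
    MorleyRankGE L (N * d : ℕ) (powerFamily N E B) := by
  refine MorleyRankGE.of_fiber (definable_powerFamily hE hB N) (b := b) ?_
  rw [fiber_powerFamily N E hb]
  exact h.power ((definable_fiber hE b).mono (Set.subset_univ _)) N

/-- Points of the family of `N`-th powers which lie over realizations of `tp(b/A)` have small
rank. -/
theorem le_of_mem_powerFamily {κ : Cardinal.{w}} (hM : IsMonster L κ M)
    (heq : MorleyEqLascar L κ M) {A : Set M} (hA : #A < κ) {ι η : Type} [Finite ι] [Finite η]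
    {E : Set (η ⊕ ι → M)} (hE : A.Definable L E) {B : Set (η → M)} (hB : A.Definable L B)
    {b : η → M} {m d : ℕ} (hm : ∀ (b' : η → M) (n : ℕ), LascarRankGE L κ n A b' → n ≤ m)
    (hd : ¬ MorleyRankGE L (d + 1 : ℕ) (fiber E b)) {N n : ℕ} {w : η ⊕ (Fin N × ι) → M}
    (hw : w ∈ powerFamily N E B) (hwb : SameType L A (w ∘ Sum.inl) b)
    (h : LascarRankGE L κ n A w) : n ≤ m + N * d := by
  have h' := h
  rw [← Sum.elim_comp_inl_inr w] at h'
  obtain ⟨b', x, i, j, hs, hij, hi, hj⟩ := h'.exists_add_eq hM.saturated hM.aleph0_lt n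
  rw [Sum.elim_comp_inl_inr] at hs
  have hmem : Sum.elim b' x ∈ powerFamily N E B :=
    (hs.mem_iff (definable_powerFamily hE hB N)).2 hw
  have hb' : SameType L A b b' := ((hs.comp Sum.inl).trans hwb).symm
  have := le_of_lascarRankGE_of_mem_power hM heq (mk_union_range_lt hM.aleph0_lt hA b')
    (definable_fiber hE b') (fun hr => hd (MorleyRankGE.fiber_congr hM hA hE hb' hr)) hmem.2 hj
  have := hm b' i hi
  omega

/-- If `MR(E_b) ≤ d`, then `MR(E_b') ≤ d` for all `b'` in a neighbourhood of `b`. -/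
theorem exists_definable_forall_not_morleyRankGE {κ : Cardinal.{w}} (hM : IsMonster L κ M)
    (hfin : HasFiniteMorleyRank L M) (heq : MorleyEqLascar L κ M) {A : Set M} (hA : #A < κ)
    {ι η : Type} [Finite ι] [Finite η] {E : Set (η ⊕ ι → M)} (hE : A.Definable L E)
    {B : Set (η → M)} (hB : A.Definable L B) {b : η → M} (hb : b ∈ B) {d : ℕ}
    (hd : ¬ MorleyRankGE L (d + 1 : ℕ) (fiber E b)) :
    ∃ B' ⊆ B, A.Definable L B' ∧ b ∈ B' ∧
      ∀ b' ∈ B', ¬ MorleyRankGE L (d + 1 : ℕ) (fiber E b') := by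
  classical
  by_contra! hcon
  obtain ⟨m, hm⟩ := exists_forall_lascarRankGE_le hM hfin heq η
  -- The jump in the rank of `N`-th powers of fibres is at least `N`, and exceeds `U(b/A)`.
  let N := m + 1
  obtain ⟨m', hm'⟩ := exists_forall_lascarRankGE_le hM hfin heq (η ⊕ (Fin N × ι))
  have hdef : ∀ {C : Set (η → M)}, A.Definable L C → A.Definable L (powerFamily N E C) :=
    fun hC => definable_powerFamily hE hC N
  have hmin : ∃ e, ∃ C ⊆ B, A.Definable L C ∧ b ∈ C ∧
      ¬ MorleyRankGE L (e + 1 : ℕ) (powerFamily N E C) := by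
    refine ⟨m', B, subset_rfl, hB, hb, fun h => ?_⟩
    obtain ⟨a, -, ha⟩ := (heq.morleyRankGE_iff hA (hdef hB)).1 h
    have := hm' A a _ hA ha
    omega
  let e := Nat.find hmin
  obtain ⟨B₁, hB₁B, hB₁, hbB₁, hB₁e⟩ := Nat.find_spec hmin
  have hlarge : N * (d + 1) ≤ e := by
    by_contra hlt
    obtain ⟨b', hb', hr⟩ := hcon B₁ hB₁B hB₁ hbB₁
    refine hB₁e ((morleyRankGE_powerFamily (hE.mono (Set.subset_univ _))
      (hB₁.mono (Set.subset_univ _)) N hb' hr).of_le ?_)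
    exact_mod_cast (by omega : e + 1 ≤ N * (d + 1))
  have hNe : m + N * d < e := by
    rw [Nat.mul_succ] at hlarge
    omega
  have hrank : ∀ C ⊆ B₁, A.Definable L C → b ∈ C → MorleyRankGE L e (powerFamily N E C) := by
    intro C hCB hC hbC
    by_contra hr
    refine Nat.find_min hmin (m := e - 1) (by omega)
      ⟨C, hCB.trans hB₁B, hC, hbC, ?_⟩
    rwa [Nat.sub_add_cancel (by omega)]
  -- From each neighbourhood of `b` a set of full rank which misses `b` can be split off.
  have hsplit : ∀ C : {C : Set (η → M) // C ⊆ B₁ ∧ A.Definable L C ∧ b ∈ C},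
      ∃ D ⊆ C.1, A.Definable L D ∧ b ∉ D ∧ MorleyRankGE L e (powerFamily N E D) := by
    rintro ⟨C, hCB, hC, hbC⟩
    obtain ⟨w, hw, hwe⟩ := (heq.morleyRankGE_iff hA (hdef hC)).1 (hrank C hCB hC hbC)
    have hnot : ¬ SameType L A (w ∘ Sum.inl) b := by
      intro hs
      have := le_of_mem_powerFamily hM heq hA hE hC (fun b' n => hm A b' n hA) hd hw hs hwe
      omega
    obtain ⟨Θ, hΘ, hwΘ, hbΘ⟩ : ∃ Θ : Set (η → M), A.Definable L Θ ∧ w ∘ Sum.inl ∈ Θ ∧ b ∉ Θ := by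
      by_contra! hno
      exact hnot (sameType_of_forall_mem hno).symm
    exact ⟨C ∩ Θ, Set.inter_subset_left, hC.inter hΘ, fun h => hbΘ h.2,
      (heq.morleyRankGE_iff hA (hdef (hC.inter hΘ))).2 ⟨w, ⟨⟨hw.1, hwΘ⟩, hw.2⟩, hwe⟩⟩
  choose D hDC hD hbD hDe using hsplit
  let C : ℕ → {C : Set (η → M) // C ⊆ B₁ ∧ A.Definable L C ∧ b ∈ C} := fun n =>
    Nat.rec ⟨B₁, subset_rfl, hB₁, hbB₁⟩ (fun _ C =>
      ⟨C.1 \ D C, Set.sdiff_subset.trans C.2.1, C.2.2.1.sdiff (hD C), C.2.2.2, hbD C⟩) n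
  have hanti : Antitone fun n => (C n).1 := antitone_nat_of_succ_le fun n => Set.sdiff_subset
  have hdis : ∀ i j, i < j → Disjoint (D (C i)) (D (C j)) := by
    intro i j hij
    refine Set.disjoint_left.2 fun x hxi hxj => ?_
    exact (hanti (Nat.succ_le_of_lt hij) (hDC _ hxj)).2 hxi
  refine hB₁e (MorleyRankGE.natCast_succ (fun n => powerFamily N E (D (C n)))
    (fun n => (hdef (hD _)).mono (Set.subset_univ _))
    (fun n => powerFamily_mono N E ((hDC _).trans (C n).2.1)) (fun n => hDe _) ?_)
  intro i j hij
  refine Set.disjoint_left.2 fun w hwi hwj => ?_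
  rcases hij.lt_or_gt with h | h
  · exact Set.disjoint_left.1 (hdis i j h) hwi.1 hwj.1
  · exact Set.disjoint_left.1 (hdis j i h) hwj.1 hwi.1

end MorleyLascar

theorem mainTheorem3 {L : FirstOrder.Language.{u, v}} (T : L.Theory) (hT : T.IsComplete)
    (κ : Cardinal.{w}) (M : Type w) [L.Structure M] [Nonempty M] [M ⊨ T]
    (hM : MorleyLascar.IsMonster L κ M)
    (hfin : MorleyLascar.HasFiniteMorleyRank L M)
    (heq : MorleyLascar.MorleyEqLascar L κ M) :
    MorleyLascar.DownwardSemiDefinable L κ M := by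
  open MorleyLascar in
  classical
  intro ι η _ _ A hA B E hB hE b hb
  by_cases hne : (fiber E b).Nonempty
  · obtain ⟨m, hm⟩ := exists_forall_lascarRankGE_le hM hfin heq ι
    have hbound : ∃ n : ℕ, ¬ MorleyRankGE L (n + 1 : ℕ) (fiber E b) := by
      refine ⟨m, fun h => ?_⟩
      have hA' := mk_union_range_lt hM.aleph0_lt hA b
      obtain ⟨a, -, ha⟩ := (heq.morleyRankGE_iff hA' (definable_fiber hE b)).1 h
      have := hm _ a _ hA' ha
      omega
    have hd := Nat.find_spec hbound
    obtain ⟨B', hB'B, hB', hbB', h⟩ :=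
      exists_definable_forall_not_morleyRankGE hM hfin heq hA hE hB hb hd
    refine ⟨B', hB'B, hB', hbB', fun b' hb' =>
      morleyRank_le_of_not_morleyRankGE_succ (h b' hb') ?_⟩
    rcases Nat.eq_zero_or_pos (Nat.find hbound) with h0 | h0
    · rw [h0]
      exact morleyRankGE_zero_iff.2 hne
    · have := Nat.find_min hbound (Nat.sub_one_lt_of_lt h0)
      rwa [not_not, Nat.sub_add_cancel h0] at this
  -- If `E_b` is empty, the rank `-∞` only bounds the rank of other empty fibres.
  · refine ⟨B ∩ {b' | ∃ x, Sum.elim b' x ∈ E}ᶜ, Set.inter_subset_left,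
      hB.inter hE.exists_of_finite.compl, ⟨hb, fun ⟨x, hx⟩ => hne ⟨x, hx⟩⟩, ?_⟩
    rintro b' ⟨-, hb'⟩
    refine sSup_le ?_
    rintro _ ⟨α, hα, rfl⟩
    exact absurd hα.nonempty hb'
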